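/- Let $\mathfrak X$ be a real Banach space, $X\subset\mathfrak X$, let $U\subset\mathbb R^m$ be open, $f:X\times U\to\mathbb R$, and $\Phi:U\to 2^X$. Put $v(u)=\inf_{x\in\Phi(u)}f(x,u)\in[-\infty,+\infty]$ and $S(u)=\{x\in\Phi(u): f(x,u)=v(u)\}$. Assume: (A1) $f$ is continuous on $X\times U$, and for every $u\in U$ there are $\alpha\in\mathbb R$ and a compact set $C\subset X$ such that $\emptyset\ne\{x\in\Phi(u'):f(x,u')\le\alpha\}\subset C$ for all $u'\in U$ in a neighborhood of $u$. (B) Either $\Phi(u)=\Phi_0$ for all $u\in U$, where $\Phi_0\subset X$ is a fixed nonempty set that is closed in $X$; or $\Phi(u)=\{x\in X: G(x,u)\in K\}$ for all $u\in U$, where $G:X\times U\to\mathcal Z$ is continuous, $\mathcal Z$ is a real topological vector space and $K\subset\mathcal Z$ is closed with nonempty interior, and moreover $G(x,u)\in\operatorname{int}K$ for all $u\in U$ and $x\in S(u)$. (Under (A1) and (B), $v$ is finite on $U$.) Write $f_x(u)=f(x,u)$ and $D_df(x,u)=D_df_x(u)=\lim_{t\downarrow0}\frac{f_x(u+td)-f_x(u)}{t}$.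 Let $u_0\in U$ and suppose that there is a neighborhood $\mathcal N\subset U$ of $u_0$ such that, for every unit vector $d\in\mathbb R^m$, $D_df$ exists and is continuous on $X\times\mathcal N$. Let $$\mathcal J^-v(u_0)=\Big\{p\in\mathbb R^m:\liminf_{u\to u_0}\frac{v(u)-v(u_0)-p\cdot(u-u_0)}{|u-u_0|}\ge0\Big\}.$$ If $\mathcal J^-v(u_0)\neq\emptyset$, then: (i) $p\cdot d=\inf_{x\in S(u_0)}D_df_x(u_0)$ for all $p\in\mathcal J^-v(u_0)$ and all unit $d\in\mathbb R^m$; (ii) $\mathcal J^-v(u_0)$ is a singleton; (iii) for every unit $d\in\mathbb R^m$, $D_df(\cdot,u_0)$ is constant on $S(u_0)$; (iv) if $v$ is differentiable at $u_0$, then for every $x\in S(u_0)$ the function $f_x$ is differentiable at $u_0$ and $\nabla v(u_0)=\nabla_uf(x,u_0)$. -/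

import Mathlib

open Set Filter Topology

universe u₁ u₂ w

namespace ParamOpt

noncomputable section

/-- The optimal value function `v(u) = inf_{x ∈ Φ(u)} f(x,u)`, with values in `[-∞,+∞]`. -/
def value {𝔛 Y : Type*} (f : 𝔛 → Y → ℝ) (Φ : Y → Set 𝔛) (u : Y) : EReal :=
  ⨅ x ∈ Φ u, (f x u : EReal)

/-- The optimal value function as a real-valued function (meaningful where `value` is finite;
under inf-compactness and closedness of the feasible sets it is finite on all of `U`). -/
def realValue {𝔛 Y : Type*} (f : 𝔛 → Y → ℝ) (Φ : Y → Set 𝔛) (u : Y) : ℝ :=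
  (value f Φ u).toReal

/-- The optimal set `S(u) = {x ∈ Φ(u) : v(u) = f(x,u)}`. -/
def optimalSet {𝔛 Y : Type*} (f : 𝔛 → Y → ℝ) (Φ : Y → Set 𝔛) (u : Y) : Set 𝔛 :=
  {x | x ∈ Φ u ∧ value f Φ u = (f x u : EReal)}

/-- Inf-compactness of `f : X × U → ℝ` on the graph of `Φ : U → 2^X`. The compact set is a
compact subset of the domain `X`. -/
def InfCompact {𝔛 Y : Type*} [TopologicalSpace 𝔛] [TopologicalSpace Y]
    (X : Set 𝔛) (U : Set Y) (f : 𝔛 → Y → ℝ) (Φ : Y → Set 𝔛) : Prop :=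
  ∀ u ∈ U, ∃ (α : ℝ) (C : Set 𝔛), IsCompact C ∧ C ⊆ X ∧
    ∀ᶠ u' in 𝓝[U] u,
      {x | x ∈ Φ u' ∧ f x u' ≤ α}.Nonempty ∧ {x | x ∈ Φ u' ∧ f x u' ≤ α} ⊆ C

/-- Condition (A1): `f` is continuous on `X × U` and inf-compact on the graph of `Φ`. -/
def ConditionA1 {𝔛 Y : Type*} [TopologicalSpace 𝔛] [TopologicalSpace Y]
    (X : Set 𝔛) (U : Set Y) (f : 𝔛 → Y → ℝ) (Φ : Y → Set 𝔛) : Prop :=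
  ContinuousOn (fun q : 𝔛 × Y => f q.1 q.2) (X ×ˢ U) ∧ InfCompact X U f Φ

/-- The feasible set does not depend on `u ∈ U`: it is a fixed nonempty subset of `X`, closed
in the (relative) topology of `X`. -/
def FixedFeasibleSet {𝔛 Y : Type*} [TopologicalSpace 𝔛]
    (X : Set 𝔛) (U : Set Y) (Φ : Y → Set 𝔛) : Prop :=
  ∃ Φ₀ : Set 𝔛, Φ₀.Nonempty ∧ Φ₀ ⊆ X ∧ IsClosed ((Subtype.val : X → 𝔛) ⁻¹' Φ₀) ∧
    ∀ u ∈ U, Φ u = Φ₀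

/-- Perturbed feasible sets: `Φ(u) = {x ∈ X : G(x,u) ∈ K}` with `G : X × U → Z` continuous into
a real topological vector space and `K` closed with nonempty interior, together with the
Slater-like condition `G(x,u) ∈ int K` for all `u ∈ U` and `x ∈ S(u)`. -/
def PerturbedFeasibleSet {𝔛 : Type u₁} {Y : Type u₂}
    [TopologicalSpace 𝔛] [TopologicalSpace Y]
    (X : Set 𝔛) (U : Set Y) (f : 𝔛 → Y → ℝ) (Φ : Y → Set 𝔛) : Prop :=
  ∃ (Z : Type w) (_ : AddCommGroup Z) (_ : Module ℝ Z) (_ : TopologicalSpace Z)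
    (_ : IsTopologicalAddGroup Z) (_ : ContinuousSMul ℝ Z) (G : 𝔛 → Y → Z) (K : Set Z),
    ContinuousOn (fun q : 𝔛 × Y => G q.1 q.2) (X ×ˢ U) ∧
    IsClosed K ∧ (interior K).Nonempty ∧
    (∀ u ∈ U, Φ u = {x | x ∈ X ∧ G x u ∈ K}) ∧
    ∀ u ∈ U, ∀ x ∈ optimalSet f Φ u, G x u ∈ interior K

/-- Condition (B): the feasible set is fixed and closed, or it is a perturbed feasible set
satisfying the Slater-like condition. -/
def ConditionB {𝔛 : Type u₁} {Y : Type u₂}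
    [TopologicalSpace 𝔛] [TopologicalSpace Y]
    (X : Set 𝔛) (U : Set Y) (f : 𝔛 → Y → ℝ) (Φ : Y → Set 𝔛) : Prop :=
  FixedFeasibleSet X U Φ ∨ PerturbedFeasibleSet.{u₁, u₂, w} X U f Φ

/-- `g` has a (one-sided) directional derivative at `u` in the direction `d`, i.e. the limit of
`(g(u + t d) - g(u)) / t` as `t ↓ 0` exists. -/
def HasDirDeriv {Y : Type*} [AddCommGroup Y] [Module ℝ Y] (g : Y → ℝ) (u d : Y) : Prop :=
  DifferentiableWithinAt ℝ (fun t : ℝ => g (u + t • d)) (Ici 0) 0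

/-- The (one-sided) directional derivative
`D_d g(u) = lim_{t ↓ 0} (g(u + t d) - g(u)) / t`. -/
def dirDeriv {Y : Type*} [AddCommGroup Y] [Module ℝ Y] (g : Y → ℝ) (u d : Y) : ℝ :=
  derivWithin (fun t : ℝ => g (u + t • d)) (Ici 0) 0

/-- `D_d f` exists and is continuous on `X × N`. -/
def DirDerivContinuousOn {𝔛 Y : Type*} [TopologicalSpace 𝔛] [TopologicalSpace Y]
    [AddCommGroup Y] [Module ℝ Y] (f : 𝔛 → Y → ℝ) (d : Y) (X : Set 𝔛) (N : Set Y) : Prop :=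
  (∀ x ∈ X, ∀ u ∈ N, HasDirDeriv (f x) u d) ∧
    ContinuousOn (fun q : 𝔛 × Y => dirDeriv (f q.1) q.2 d) (X ×ˢ N)

/-- The set `J⁻w(u₀)` of viscosity subgradients: all `p` with
`liminf_{u → u₀} (w(u) - w(u₀) - p·(u - u₀)) / |u - u₀| ≥ 0`, the lower limit being taken in
`[-∞,+∞]`. -/
def subJet {Y : Type*} [NormedAddCommGroup Y] [InnerProductSpace ℝ Y]
    (w : Y → ℝ) (u₀ : Y) : Set Y :=
  {p | (0 : EReal) ≤ liminf
    (fun u => (((w u - w u₀ - inner ℝ p (u - u₀)) / ‖u - u₀‖ : ℝ) : EReal)) (𝓝[≠] u₀)}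

end

end ParamOpt

/-!
Every optimal point `x ∈ S(u₀)` stays feasible for `u` near `u₀`, either because the feasible set
is fixed or because `G(x, u₀)` is interior to `K`. Hence `f_x` lies above `v` near `u₀` and touches
it at `u₀`, so that `J⁻v(u₀) ⊆ J⁻f_x(u₀)` (`subJet_subset_of_le`). Comparing real-valued functions
here requires `v` to be finite near `u₀`; this holds because the infimum is attained at every point
of `U` (`optimalSet_nonempty`).

Continuity of the one-sided directional derivatives of `f_x` along the coordinate axes makes `f_x`
differentiable at `u₀` (`differentiableAt_of_continuousAt_dirDeriv`), and for a function
differentiable at `u₀` the set of subgradients reduces to the gradient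
(`subJet_eq_of_differentiableAt`). So every `p ∈ J⁻v(u₀)` equals `∇f_x(u₀)` for each `x ∈ S(u₀)`,
and all the assertions follow; no formula for the directional derivative of `v` is needed.
-/

namespace ParamOpt

/-! ### Viscosity subgradients -/

section SubJet

variable {Y : Type*} [NormedAddCommGroup Y] [InnerProductSpace ℝ Y]

lemma mem_subJet_iff {w : Y → ℝ} {u₀ p : Y} :
    p ∈ subJet w u₀ ↔ ∀ ε > 0, ∀ᶠ u in 𝓝 u₀,
      -(ε * ‖u - u₀‖) ≤ w u - w u₀ - inner ℝ p (u - u₀) := by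
  have key : ∀ (a b ε : ℝ), 0 < b → (-ε ≤ a / b ↔ -(ε * b) ≤ a) := by
    intro a b ε hb
    rw [le_div_iff₀ hb, neg_mul]
  unfold subJet
  rw [mem_ofPred_eq, le_liminf_iff]
  constructor
  · intro h ε hε
    have h1 := h ((-ε : ℝ) : EReal) (by exact_mod_cast neg_lt_zero.2 hε)
    rw [eventually_nhdsWithin_iff] at h1
    filter_upwards [h1] with u hu
    by_cases hne : u = u₀
    · simp [hne]
    · exact (key _ _ _ (norm_pos_iff.2 (sub_ne_zero.2 hne))).1
        (by exact_mod_cast (hu hne).le)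
  · intro h y hy
    obtain ⟨z, hyz, hz0⟩ := EReal.lt_iff_exists_real_btwn.1 hy
    have hz : z < 0 := by exact_mod_cast hz0
    rw [eventually_nhdsWithin_iff]
    filter_upwards [h (-z) (by linarith)] with u hu hne
    have h2 := (key _ _ _ (norm_pos_iff.2 (sub_ne_zero.2 hne))).2 hu
    rw [neg_neg] at h2
    exact hyz.trans_le (by exact_mod_cast h2)

/-- Subgradients pass to a function touching `w` from above at `u₀`. -/
lemma subJet_subset_of_le {w g : Y → ℝ} {u₀ : Y} (h₀ : w u₀ = g u₀)
    (hle : ∀ᶠ u in 𝓝 u₀, w u ≤ g u) : subJet w u₀ ⊆ subJet g u₀ := by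
  intro p hp
  rw [mem_subJet_iff] at hp ⊢
  intro ε hε
  filter_upwards [hp ε hε, hle] with u h1 h2
  linarith

lemma subJet_eq_of_differentiableAt [CompleteSpace Y] {g : Y → ℝ} {u₀ : Y}
    (hg : DifferentiableAt ℝ g u₀) : subJet g u₀ = {gradient g u₀} := by
  have ho := hasGradientAt_iff_isLittleO.1 hg.hasGradientAt
  rw [Asymptotics.isLittleO_iff] at ho
  ext p
  rw [mem_singleton_iff]
  constructor
  · intro hp
    rw [mem_subJet_iff] at hp
    by_contra hne
    set r := p - gradient g u₀ with hr
    have hrpos : 0 < ‖r‖ := norm_pos_iff.2 (sub_ne_zero.2 hne)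
    have hε : 0 < ‖r‖ / 4 := by positivity
    -- The two expansions give `⟪r, u - u₀⟫ ≤ ‖r‖ / 2 * ‖u - u₀‖`, which fails along `r` itself.
    have hev := (hp _ hε).and (ho hε)
    have hlim : Tendsto (fun t : ℝ => u₀ + t • r) (𝓝[>] 0) (𝓝 u₀) := by
      have hc : Continuous (fun t : ℝ => u₀ + t • r) := by fun_prop
      have := hc.tendsto 0
      rw [zero_smul, add_zero] at this
      exact this.mono_left nhdsWithin_le_nhds
    obtain ⟨t, ⟨h1, h2⟩, ht⟩ := ((hlim.eventually hev).and self_mem_nhdsWithin).exists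
    have ht : 0 < t := ht
    rw [add_sub_cancel_left, norm_smul, Real.norm_of_nonneg ht.le] at h1 h2
    rw [Real.norm_eq_abs] at h2
    have h3 := (abs_le.1 h2).2
    have h4 : inner ℝ p (t • r) - inner ℝ (gradient g u₀) (t • r) = t * (‖r‖ * ‖r‖) := by
      rw [← inner_sub_left, ← hr, inner_smul_right, real_inner_self_eq_norm_mul_norm]
    have h5 : 0 < t * (‖r‖ * ‖r‖) := by positivity
    linarith
  · rintro rfl
    rw [mem_subJet_iff]
    intro ε hε
    filter_upwards [ho hε] with u hu
    exact (abs_le.1 (by simpa only [Real.norm_eq_abs] using hu)).1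

end SubJet

/-! ### One-sided directional derivatives and differentiability -/

lemma HasDirDeriv.hasDerivWithinAt {Y : Type*} [AddCommGroup Y] [Module ℝ Y] {g : Y → ℝ}
    {u d : Y} {t : ℝ} (h : HasDirDeriv g (u + t • d) d) :
    HasDerivWithinAt (fun s : ℝ => g (u + s • d)) (dirDeriv g (u + t • d) d) (Ici t) t := by
  have h1 : HasDerivWithinAt (fun s : ℝ => g (u + t • d + s • d))
      (dirDeriv g (u + t • d) d) (Ici 0) (t - t) := by
    rw [sub_self]
    exact DifferentiableWithinAt.hasDerivWithinAt h
  have h2 : HasDerivWithinAt (fun s : ℝ => s - t) 1 (Ici t) t :=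
    ((hasDerivAt_id t).sub_const t).hasDerivWithinAt
  have h3 := HasDerivWithinAt.comp (h := fun s : ℝ => s - t) t h1 h2
    (fun s hs => mem_Ici.2 (sub_nonneg.2 hs))
  rw [mul_one] at h3
  refine h3.congr_of_mem (fun s _ => ?_) self_mem_Ici
  simp only [Function.comp_apply]
  congr 1
  module

lemma dirDeriv_eq_inner_gradient {Y : Type*} [NormedAddCommGroup Y] [InnerProductSpace ℝ Y]
    [CompleteSpace Y] {g : Y → ℝ} {u : Y} (hg : DifferentiableAt ℝ g u) (d : Y) :
    dirDeriv g u d = inner ℝ (gradient g u) d := by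
  have h1 : HasDerivAt (fun t : ℝ => u + t • d) d 0 := by
    simpa using ((hasDerivAt_id (0 : ℝ)).smul_const d).const_add u
  have h2 : HasFDerivAt g (InnerProductSpace.toDual ℝ Y (gradient g u)) (u + (0 : ℝ) • d) := by
    rw [zero_smul, add_zero]
    exact hg.hasGradientAt.hasFDerivAt
  have h3 := (h2.comp_hasDerivAt 0 h1).hasDerivWithinAt (s := Ici 0)
  exact (h3.derivWithin (uniqueDiffOn_Ici 0 0 self_mem_Ici)).trans
    (InnerProductSpace.toDual_apply_apply ..)

/-- Mean value estimate: on a convex set where the one-sided derivative along `d` is within `ε`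
of `c`, increments along `d` of either sign are within `ε` of `c` times the step. -/
lemma abs_sub_sub_mul_le_of_dirDeriv {Y : Type*} [NormedAddCommGroup Y] [NormedSpace ℝ Y]
    {g : Y → ℝ} {B : Set Y} (hB : Convex ℝ B) (hg : ContinuousOn g B) {d : Y} {c ε : ℝ}
    (hdir : ∀ u ∈ B, HasDirDeriv g u d) (hbd : ∀ u ∈ B, |dirDeriv g u d - c| ≤ ε)
    {u : Y} {s : ℝ} (hu : u ∈ B) (hus : u + s • d ∈ B) :
    |g (u + s • d) - g u - s * c| ≤ ε * |s| := by
  have pos : ∀ (u : Y) (s : ℝ), 0 ≤ s → u ∈ B → u + s • d ∈ B →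
      |g (u + s • d) - g u - s * c| ≤ ε * s := by
    intro u s hs hu hus
    have hmem : ∀ t ∈ Icc 0 s, u + t • d ∈ B := by
      intro t ht
      rcases hs.eq_or_lt with rfl | hs'
      · simpa [le_antisymm ht.2 ht.1] using hu
      · have := hB.add_smul_mem hu hus (t := t / s)
          ⟨div_nonneg ht.1 hs, div_le_one_of_le₀ ht.2 hs⟩
        rwa [smul_smul, div_mul_cancel₀ _ hs'.ne'] at this
    have hmv := norm_image_sub_le_of_norm_deriv_right_le_segment
      (f := fun t : ℝ => g (u + t • d) - t * c) (f' := fun t => dirDeriv g (u + t • d) d - c)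
      (a := 0) (b := s) (C := ε) ?_ ?_ ?_ s (right_mem_Icc.2 hs)
    · simp only [Real.norm_eq_abs, zero_smul, add_zero, zero_mul, sub_zero] at hmv
      rwa [sub_right_comm] at hmv
    · exact (hg.comp (by fun_prop) hmem).sub (by fun_prop)
    · intro t ht
      have h1 := (hdir _ (hmem t (Ico_subset_Icc_self ht))).hasDerivWithinAt
      have h2 := ((hasDerivAt_id t).mul_const c).hasDerivWithinAt (s := Ici t)
      rw [one_mul] at h2
      exact h1.sub h2
    · intro t ht
      exact hbd _ (hmem t (Ico_subset_Icc_self ht))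
  rcases le_total 0 s with hs | hs
  · rw [abs_of_nonneg hs]
    exact pos u s hs hu hus
  · -- Run the segment backwards, from `u + s • d` to `u`.
    have hback : u + s • d + (-s) • d = u := by module
    have h := pos (u + s • d) (-s) (neg_nonneg.2 hs) hus (by rwa [hback])
    rw [hback] at h
    rw [abs_of_nonpos hs, ← abs_neg]
    convert h using 2
    ring

/-- Continuous one-sided partial derivatives imply differentiability. -/
theorem differentiableAt_of_continuousAt_dirDeriv {m : ℕ} {g : EuclideanSpace ℝ (Fin m) → ℝ}
    {N : Set (EuclideanSpace ℝ (Fin m))} {u₀ : EuclideanSpace ℝ (Fin m)} (hN : N ∈ 𝓝 u₀)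
    (hg : ContinuousOn g N)
    (hdir : ∀ i, ∀ u ∈ N, HasDirDeriv g u (EuclideanSpace.single i 1))
    (hcont : ∀ i, ContinuousAt (fun u => dirDeriv g u (EuclideanSpace.single i 1)) u₀) :
    DifferentiableAt ℝ g u₀ := by
  set e : Fin m → EuclideanSpace ℝ (Fin m) := fun i => EuclideanSpace.single i 1 with he
  set c : Fin m → ℝ := fun i => dirDeriv g u₀ (e i) with hc
  set L : EuclideanSpace ℝ (Fin m) →L[ℝ] ℝ := ∑ i, c i • EuclideanSpace.proj i with hL
  refine HasFDerivAt.differentiableAt (f' := L) ?_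
  rw [hasFDerivAt_iff_isLittleO, Asymptotics.isLittleO_iff]
  intro η hη
  set ε : ℝ := η / (m + 1) with hεdef
  have hε : 0 < ε := by positivity
  have hev : ∀ᶠ u in 𝓝 u₀, u ∈ N ∧ ∀ i, |dirDeriv g u (e i) - c i| ≤ ε := by
    refine Filter.Eventually.and hN (eventually_all.2 fun i => ?_)
    filter_upwards [Metric.tendsto_nhds.1 (hcont i) ε hε] with u hu
    exact (Real.dist_eq _ _ ▸ hu).le
  obtain ⟨δ, hδ, hball⟩ := Metric.eventually_nhds_iff_ball.1 hev
  filter_upwards [Metric.ball_mem_nhds u₀ hδ] with u hu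
  set h := u - u₀ with hh
  -- Change the coordinates one at a time; truncating `h` does not increase its norm.
  have hmem : ∀ I : Finset (Fin m), u₀ + ∑ i ∈ I, h i • e i ∈ Metric.ball u₀ δ := by
    intro I
    rw [mem_ball_iff_norm, add_sub_cancel_left]
    refine lt_of_le_of_lt ?_ (mem_ball_iff_norm.1 hu)
    rw [EuclideanSpace.norm_eq, EuclideanSpace.norm_eq]
    refine Real.sqrt_le_sqrt (Finset.sum_le_sum fun j _ => ?_)
    have hj : (∑ i ∈ I, h i • e i) j = if j ∈ I then h j else 0 := by
      simp [he, Pi.single_apply]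
    rw [hj]
    split_ifs
    · exact le_rfl
    · rw [norm_zero, sq, zero_mul]
      positivity
  have hstep : ∀ I : Finset (Fin m),
      |g (u₀ + ∑ i ∈ I, h i • e i) - g u₀ - ∑ i ∈ I, h i * c i| ≤ ε * ∑ i ∈ I, |h i| := by
    intro I
    induction I using Finset.induction_on with
    | empty => simp
    | insert j I hj ih =>
      have h1 := hmem (insert j I)
      have h2 : u₀ + ∑ i ∈ insert j I, h i • e i = u₀ + ∑ i ∈ I, h i • e i + h j • e j := by
        rw [Finset.sum_insert hj]
        abel
      rw [h2] at h1 ⊢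
      have h3 := abs_sub_sub_mul_le_of_dirDeriv (convex_ball u₀ δ)
        (hg.mono fun z hz => (hball z hz).1) (fun z hz => hdir j z (hball z hz).1)
        (fun z hz => (hball z hz).2 j) (hmem I) h1
      rw [Finset.sum_insert hj, Finset.sum_insert hj, mul_add]
      refine le_trans (le_of_eq ?_) ((abs_add_le _ _).trans (add_le_add h3 ih))
      congr 1
      ring
  have hsum : ∑ i, h i • e i = h := by
    ext j
    simp [he, Pi.single_apply]
  have hfin := hstep Finset.univ
  rw [hsum, hh, add_sub_cancel, ← hh] at hfin
  have hLh : L h = ∑ i, h i * c i := by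
    simp [hL, mul_comm]
  rw [hLh, Real.norm_eq_abs]
  refine hfin.trans ?_
  have hcoord : ∑ i, |h i| ≤ m * ‖h‖ := by
    have := Finset.sum_le_card_nsmul Finset.univ (fun i => |h i|) ‖h‖
      (fun i _ => by simpa using PiLp.norm_apply_le h i)
    simpa using this
  calc ε * ∑ i, |h i| ≤ ε * ((m + 1) * ‖h‖) := by
        gcongr
        linarith [norm_nonneg h]
    _ = η * ‖h‖ := by
        rw [hεdef]
        field_simp

/-! ### Optimal points and the value function -/

lemma realValue_eq_of_mem_optimalSet {𝔛 Y : Type*} {f : 𝔛 → Y → ℝ} {Φ : Y → Set 𝔛} {u : Y} {x : 𝔛}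
    (hx : x ∈ optimalSet f Φ u) :
    realValue f Φ u = f x u := by
  rw [realValue, hx.2, EReal.toReal_coe]

lemma realValue_le {𝔛 Y : Type*} {f : 𝔛 → Y → ℝ} {Φ : Y → Set 𝔛} {u : Y}
    (hS : (optimalSet f Φ u).Nonempty) {x : 𝔛} (hx : x ∈ Φ u) :
    realValue f Φ u ≤ f x u := by
  obtain ⟨y, hy⟩ := hS
  rw [realValue_eq_of_mem_optimalSet hy]
  have h : value f Φ u ≤ (f x u : EReal) := iInf₂_le x hx
  rw [hy.2] at h
  exact_mod_cast h

section Value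

variable {𝔛 : Type u₁} {Y : Type u₂} [TopologicalSpace 𝔛] [TopologicalSpace Y]
  {X : Set 𝔛} {U : Set Y} {f : 𝔛 → Y → ℝ} {Φ : Y → Set 𝔛}

/-- In both cases of condition (B) the feasible sets are relatively closed in `X`. -/
lemma ConditionB.exists_isClosed_feasible_eq (hB : ConditionB.{u₁, u₂, w} X U f Φ) {u : Y}
    (hu : u ∈ U) : ∃ F : Set 𝔛, IsClosed F ∧ Φ u = X ∩ F := by
  rcases hB with ⟨Φ₀, -, hsub, hcl, hΦ⟩ | ⟨Z, _, _, _, _, _, G, K, hGc, hK, -, hΦ, -⟩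
  · obtain ⟨F, hF, hFe⟩ := isClosed_induced_iff.1 hcl
    refine ⟨F, hF, ?_⟩
    rw [hΦ u hu, ← inter_eq_right.2 hsub]
    exact (Subtype.preimage_val_eq_preimage_val_iff _ _ _).1 hFe.symm
  · have hGu : ContinuousOn (G · u) X :=
      hGc.comp (f := fun x => (x, u)) (by fun_prop) fun x hx => ⟨hx, hu⟩
    obtain ⟨F, hF, hFe⟩ := continuousOn_iff_isClosed.1 hGu K hK
    refine ⟨F, hF, ?_⟩
    rw [hΦ u hu, inter_comm X F, ← hFe, inter_comm]
    rfl

/-- The infimum is attained at every parameter in `U`, so the value function is finite there. -/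
lemma optimalSet_nonempty (hA : ConditionA1 X U f Φ) (hB : ConditionB.{u₁, u₂, w} X U f Φ)
    {u : Y} (hu : u ∈ U) : (optimalSet f Φ u).Nonempty := by
  obtain ⟨F, hF, hΦ⟩ := hB.exists_isClosed_feasible_eq hu
  obtain ⟨α, C, hC, hCX, hev⟩ := hA.2 u hu
  obtain ⟨⟨x₀, hx₀Φ, hx₀α⟩, hsub⟩ := hev.self_of_nhdsWithin hu
  have hcont : ContinuousOn (f · u) X :=
    hA.1.comp (f := fun x => (x, u)) (by fun_prop) fun x hx => ⟨hx, hu⟩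
  have hx₀F : x₀ ∈ C ∩ F := ⟨hsub ⟨hx₀Φ, hx₀α⟩, (hΦ ▸ hx₀Φ).2⟩
  obtain ⟨y, hy, hmin⟩ := (hC.inter_right hF).exists_isMinOn ⟨x₀, hx₀F⟩
    (hcont.mono (inter_subset_left.trans hCX))
  have hyΦ : y ∈ Φ u := hΦ ▸ ⟨hCX hy.1, hy.2⟩
  refine ⟨y, hyΦ, le_antisymm (iInf₂_le y hyΦ) (le_iInf₂ fun x hx => ?_)⟩
  rw [EReal.coe_le_coe_iff]
  -- Points outside the level set have value above `α ≥ f x₀ u ≥ f y u`.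
  rcases le_or_gt (f x u) α with hxα | hxα
  · exact hmin ⟨hsub ⟨hx, hxα⟩, (hΦ ▸ hx).2⟩
  · exact (hmin hx₀F).trans (hx₀α.trans hxα.le)

lemma mem_of_mem_optimalSet (hB : ConditionB.{u₁, u₂, w} X U f Φ) {u : Y} (hu : u ∈ U) {x : 𝔛}
    (hx : x ∈ optimalSet f Φ u) : x ∈ X := by
  obtain ⟨F, -, hΦ⟩ := hB.exists_isClosed_feasible_eq hu
  exact (hΦ ▸ hx.1).1

/-- An optimal point remains feasible under small perturbations of the parameter. -/
lemma eventually_mem_feasible (hU : IsOpen U) (hB : ConditionB.{u₁, u₂, w} X U f Φ) {u₀ : Y}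
    (hu₀ : u₀ ∈ U) {x : 𝔛} (hx : x ∈ optimalSet f Φ u₀) : ∀ᶠ u in 𝓝 u₀, x ∈ Φ u := by
  have hxX := mem_of_mem_optimalSet hB hu₀ hx
  rcases hB with ⟨Φ₀, -, -, -, hΦ⟩ | ⟨Z, _, _, _, _, _, G, K, hGc, -, -, hΦ, hint⟩
  · filter_upwards [hU.mem_nhds hu₀] with u hu
    rw [hΦ u hu, ← hΦ u₀ hu₀]
    exact hx.1
  · have hc : ContinuousAt (G x) u₀ :=
      (hGc.comp (f := fun u => (x, u)) (by fun_prop) fun u hu => ⟨hxX, hu⟩).continuousAt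
        (hU.mem_nhds hu₀)
    filter_upwards [hU.mem_nhds hu₀,
      hc.preimage_mem_nhds (isOpen_interior.mem_nhds (hint u₀ hu₀ x hx))] with u hu hGu
    rw [hΦ u hu]
    exact ⟨hxX, interior_subset hGu⟩

end Value

end ParamOpt

theorem corollary5p12 {𝔛 : Type u₁} [NormedAddCommGroup 𝔛] [NormedSpace ℝ 𝔛]
    [CompleteSpace 𝔛] {m : ℕ} (X : Set 𝔛) (U : Set (EuclideanSpace ℝ (Fin m)))
    (f : 𝔛 → EuclideanSpace ℝ (Fin m) → ℝ) (Φ : EuclideanSpace ℝ (Fin m) → Set 𝔛)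
    (hU : IsOpen U)
    (hA1 : ParamOpt.ConditionA1 X U f Φ)
    (hB : ParamOpt.ConditionB.{u₁, 0, w} X U f Φ)
    (u₀ : EuclideanSpace ℝ (Fin m)) (hu₀ : u₀ ∈ U)
    (hDf : ∃ N ∈ 𝓝 u₀, N ⊆ U ∧
      ∀ d : EuclideanSpace ℝ (Fin m), ‖d‖ = 1 → ParamOpt.DirDerivContinuousOn f d X N)
    (hJ : (ParamOpt.subJet (ParamOpt.realValue f Φ) u₀).Nonempty) :
    (∀ p ∈ ParamOpt.subJet (ParamOpt.realValue f Φ) u₀,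
      ∀ d : EuclideanSpace ℝ (Fin m), ‖d‖ = 1 →
        IsGLB ((fun x => ParamOpt.dirDeriv (f x) u₀ d) '' ParamOpt.optimalSet f Φ u₀)
          (inner ℝ p d)) ∧
    (∃ p, ParamOpt.subJet (ParamOpt.realValue f Φ) u₀ = {p}) ∧
    (∀ d : EuclideanSpace ℝ (Fin m), ‖d‖ = 1 →
      ∃ c : ℝ, ∀ x ∈ ParamOpt.optimalSet f Φ u₀, ParamOpt.dirDeriv (f x) u₀ d = c) ∧
    (DifferentiableAt ℝ (ParamOpt.realValue f Φ) u₀ →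
      ∀ x ∈ ParamOpt.optimalSet f Φ u₀,
        DifferentiableAt ℝ (f x) u₀ ∧
          gradient (ParamOpt.realValue f Φ) u₀ = gradient (f x) u₀) := by
  obtain ⟨N, hN, hNU, hD⟩ := hDf
  have hdiff : ∀ x ∈ ParamOpt.optimalSet f Φ u₀, DifferentiableAt ℝ (f x) u₀ := by
    intro x hx
    have hxX := ParamOpt.mem_of_mem_optimalSet hB hu₀ hx
    have hunit (i : Fin m) : ‖(EuclideanSpace.single i 1 : EuclideanSpace ℝ (Fin m))‖ = 1 := by
      simp
    refine ParamOpt.differentiableAt_of_continuousAt_dirDeriv hN ?_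
      (fun i u hu => (hD _ (hunit i)).1 x hxX u hu) fun i => ?_
    · exact hA1.1.comp (f := fun u => (x, u)) (by fun_prop) fun u hu => ⟨hxX, hNU hu⟩
    · exact ((hD _ (hunit i)).2.comp (f := fun u => (x, u)) (by fun_prop)
        fun u hu => ⟨hxX, hu⟩).continuousAt hN
  have hgrad : ∀ p ∈ ParamOpt.subJet (ParamOpt.realValue f Φ) u₀,
      ∀ x ∈ ParamOpt.optimalSet f Φ u₀, p = gradient (f x) u₀ := by
    intro p hp x hx
    have hle : ∀ᶠ u in 𝓝 u₀, ParamOpt.realValue f Φ u ≤ f x u := by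
      filter_upwards [hU.mem_nhds hu₀, ParamOpt.eventually_mem_feasible hU hB hu₀ hx]
        with u hu hxu
      exact ParamOpt.realValue_le (ParamOpt.optimalSet_nonempty hA1 hB hu) hxu
    have hpx := ParamOpt.subJet_subset_of_le
      (ParamOpt.realValue_eq_of_mem_optimalSet hx) hle hp
    rwa [ParamOpt.subJet_eq_of_differentiableAt (hdiff x hx)] at hpx
  have hdir : ∀ p ∈ ParamOpt.subJet (ParamOpt.realValue f Φ) u₀,
      ∀ d, ∀ x ∈ ParamOpt.optimalSet f Φ u₀, ParamOpt.dirDeriv (f x) u₀ d = inner ℝ p d := by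
    intro p hp d x hx
    rw [ParamOpt.dirDeriv_eq_inner_gradient (hdiff x hx), hgrad p hp x hx]
  have hS := ParamOpt.optimalSet_nonempty hA1 hB hu₀
  obtain ⟨q, hq⟩ := hJ
  refine ⟨fun p hp d _ => ?_, ⟨q, ?_⟩, fun d _ => ⟨inner ℝ q d, hdir q hq d⟩, fun hv x hx => ?_⟩
  · rw [image_congr (hdir p hp d), hS.image_const]
    exact isGLB_singleton
  · obtain ⟨x, hx⟩ := hS
    exact eq_singleton_iff_unique_mem.2
      ⟨hq, fun p hp => (hgrad p hp x hx).trans (hgrad q hq x hx).symm⟩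
  · refine ⟨hdiff x hx, hgrad _ ?_ x hx⟩
    rw [ParamOpt.subJet_eq_of_differentiableAt hv]
    exact mem_singleton _
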